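/- Let $d\ge 1$ and let $\Omega\subset\mathbb{R}^d$ be a Borel set with $|\Omega|<\infty$ and finite perimeter, i.e. the distributional gradient $D\mathbf 1_\Omega$ is an $\mathbb{R}^d$-valued measure of finite total variation $|D\mathbf 1_\Omega|$; put $\mathrm{Per}(\Omega)=|D\mathbf 1_\Omega|(\mathbb{R}^d)$. Let $B_1$ be the closed unit ball centred at the origin, $\Omega+hB_1$ the Minkowski sum, $\widehat{\mathbf 1}_S(\xi)=\int_S e^{-2\pi i\xi\cdot x}\,dx$ for $|S|<\infty$, and $\mathcal F\{\mu\}(\xi)=\int_{\mathbb{R}^d} e^{-2\pi i\xi\cdot x}\,d\mu(x)$ for a finite measure $\mu$. Let $$\mathcal{SM}(\Omega)=\lim_{r\to0^+}\frac{|\{x:\operatorname{dist}(x,\Omega)\le r\}\setminus\Omega|}{r}$$ be the outer Minkowski content of $\Omega$ (whenever this limit exists). Then the following are equivalent: (i) $|\Omega+hB_1|<\infty$ for all sufficiently small $h>0$, and $$\lim_{h\to0^+}\frac{\widehat{\mathbf 1}_{\Omega+hB_1}(\xi)-\widehat{\mathbf 1}_\Omega(\xi)}{h}=\mathcal F\{|D\mathbf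 1_\Omega|\}(\xi)\qquad\text{for every }\xi\in\mathbb{R}^d;$$ (ii) the limit defining $\mathcal{SM}(\Omega)$ exists and $\mathcal{SM}(\Omega)=\mathrm{Per}(\Omega)$. -/

import Mathlib

open MeasureTheory Filter Topology Set
open scoped ENNReal ContDiff Gradient FourierTransform Pointwise RealInnerProductSpace

noncomputable section

/-- `ℝᵈ` with its Euclidean norm, inner product and Lebesgue measure `volume`. -/
abbrev Rd (d : ℕ) : Type := EuclideanSpace ℝ (Fin d)

/-- The `ℝᵈ`-valued measure `D` is the distributional gradient of `u`:
`∫ u ∇φ dx = - ∫ φ dD` for every test function `φ ∈ C_c^∞(ℝᵈ)`. -/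
def IsDistribGradient {d : ℕ} (u : Rd d → ℝ) (D : VectorMeasure (Rd d) (Rd d)) : Prop :=
  ∀ φ : Rd d → ℝ, ContDiff ℝ ∞ φ → HasCompactSupport φ →
    ∫ x, u x • ∇ φ x = - ∫ᵛ x, φ x ∂•D

/-- The distributional gradient of `u` is a vector-valued measure of finite total variation. -/
def HasMeasureGradient {d : ℕ} (u : Rd d → ℝ) : Prop :=
  ∃ D : VectorMeasure (Rd d) (Rd d), IsFiniteMeasure D.variation ∧ IsDistribGradient u D

/-- `u ∈ BV(ℝᵈ)`: `u` is integrable and its distributional gradient is a finite measure. -/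
def IsBV {d : ℕ} (u : Rd d → ℝ) : Prop :=
  Integrable u ∧ HasMeasureGradient u

open Classical in
/-- The distributional gradient `Du` as a vector-valued measure
(zero by convention if the gradient is not a finite measure). -/
def distribGradient {d : ℕ} (u : Rd d → ℝ) : VectorMeasure (Rd d) (Rd d) :=
  if h : HasMeasureGradient u then h.choose else 0

/-- The real-valued characteristic function of `Ω`. -/
def charFn {d : ℕ} (Ω : Set (Rd d)) : Rd d → ℝ := Ω.indicator 1

/-- The total variation measure `|D 1_Ω|`. -/
def perimeterMeasure {d : ℕ} (Ω : Set (Rd d)) : Measure (Rd d) :=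
  (distribGradient (charFn Ω)).variation

open Classical in
/-- `Per(Ω) = |D 1_Ω|(ℝᵈ)`, which is `∞` if `D 1_Ω` is not a finite measure. -/
def perimeter {d : ℕ} (Ω : Set (Rd d)) : ℝ≥0∞ :=
  if HasMeasureGradient (charFn Ω) then perimeterMeasure Ω univ else ⊤

/-- A Borel set of finite perimeter (and finite measure): `1_Ω ∈ BV(ℝᵈ)`. -/
def IsFinitePerimeter {d : ℕ} (Ω : Set (Rd d)) : Prop :=
  MeasurableSet Ω ∧ IsBV (charFn Ω)

/-- `SM(Ω) = m`: the limit of `|Ω_r \ Ω| / r` as `r → 0⁺` exists and equals `m`, where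
`Ω_r = {x | dist(x, Ω) ≤ r}` is the closed `r`-neighbourhood of `Ω`. -/
def HasOuterMinkowskiContent {d : ℕ} (Ω : Set (Rd d)) (m : ℝ≥0∞) : Prop :=
  Tendsto (fun r : ℝ => volume (Metric.cthickening r Ω \ Ω) / ENNReal.ofReal r) (𝓝[>] 0) (𝓝 m)

/-- The Fourier transform `∫ 1_S(x) e^{-2πi ξ·x} dx` of the characteristic function of `S`. -/
def fourierSet {d : ℕ} (S : Set (Rd d)) (ξ : Rd d) : ℂ :=
  𝓕 (fun x => (charFn S x : ℂ)) ξ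

/-- The Fourier transform `∫ e^{-2πi ξ·x} dμ(x)` of a measure. -/
def fourierMeasure {d : ℕ} (μ : Measure (Rd d)) (ξ : Rd d) : ℂ :=
  ∫ x, Complex.exp (((-2 * Real.pi * ⟪ξ, x⟫ : ℝ) : ℂ) * Complex.I) ∂μ

/-- The Minkowski sum `Ω + h B₁`, with `B₁` the closed unit ball centred at the origin. -/
def enlarge {d : ℕ} (Ω : Set (Rd d)) (h : ℝ) : Set (Rd d) :=
  Ω + h • Metric.closedBall (0 : Rd d) 1

end

/-! Both sides speak of the collar measures `collarMeasure Ω h`. Up to null sets, `Ω + hB₁` is the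
closed `h`-neighbourhood, so (ii) says that their masses tend to `Per(Ω)`, while the quotient in (i)
is their Fourier transform. Taking `ξ = 0` in (i) gives (ii). Conversely, integrating a difference
quotient by parts against `1_Ω` shows that on every open set the variation of `D 1_Ω` is at most the
liminf of the collar masses (`variation_le_liminf_collarMeasure`). Together with convergence of the
total masses this gives weak convergence, which is tested on the bounded continuous characters. -/

/-! ### Minkowski sums and neighbourhoods agree up to null sets -/

/-- In Euclidean space the closed and the open thickening of a set differ by a null set. -/
theorem volume_cthickening_diff_thickening {d : ℕ} (s : Set (Rd d)) {r : ℝ} (hr : 0 < r) :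
    volume (Metric.cthickening r s \ Metric.thickening r s) = 0 := by
  set E := Metric.cthickening r s \ Metric.thickening r s
  have hEm : MeasurableSet E :=
    Metric.isClosed_cthickening.measurableSet.diff Metric.isOpen_thickening.measurableSet
  -- Lebesgue density along off-centre balls: slide from `x` towards a nearest point `y` of the
  -- closure. The ball of radius `r/(n+1)` about the point reached has its interior in the open
  -- thickening, so it meets `E` only in its sphere and the density there is `0`, not `1`.
  have hdens := IsUnifLocDoublingMeasure.ae_tendsto_measure_inter_div
    (volume : Measure (Rd d)) E 1
  rw [ae_restrict_iff' hEm] at hdens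
  refine measure_mono_null (fun x hx => ?_) (ae_iff.1 hdens)
  intro H
  obtain ⟨y, hy, hxy⟩ : ∃ y ∈ closure s, dist x y ≤ r := by
    have h1 := hx.1
    rw [Metric.cthickening_eq_biUnion_closedBall _ hr.le] at h1
    simpa using h1
  have hδ : Tendsto (fun n : ℕ => r / (n + 1)) atTop (𝓝[>] 0) := by
    refine tendsto_nhdsWithin_iff.2 ⟨?_, Eventually.of_forall fun n => ?_⟩
    · simpa [div_eq_mul_inv] using (tendsto_one_div_add_atTop_nhds_zero_nat (𝕜 := ℝ)).const_mul r
    · exact div_pos hr (by positivity)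
  have H1 := H hx (l := atTop)
    (fun n : ℕ => x + (1 / ((n : ℝ) + 1)) • (y - x)) (fun n => r / (n + 1)) hδ ?_
  swap
  · refine Eventually.of_forall fun n => ?_
    rw [Metric.mem_closedBall, dist_eq_norm, sub_add_cancel_left, norm_neg, norm_smul,
      ← dist_eq_norm, dist_comm, Real.norm_of_nonneg (by positivity), one_mul, div_mul_eq_mul_div, one_mul]
    gcongr
  have H2 : ∀ n : ℕ, volume (E ∩ Metric.closedBall (x + (1 / ((n : ℝ) + 1)) • (y - x)) (r / (n + 1)))
      / volume (Metric.closedBall (x + (1 / ((n : ℝ) + 1)) • (y - x)) (r / (n + 1))) = 0 := by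
    intro n
    have hn : (0 : ℝ) < n + 1 := by positivity
    have hpos : 0 < r / ((n : ℝ) + 1) := by positivity
    have hs : E ∩ Metric.closedBall (x + (1 / ((n : ℝ) + 1)) • (y - x)) (r / (n + 1)) ⊆
        Metric.sphere (x + (1 / ((n : ℝ) + 1)) • (y - x)) (r / (n + 1)) := by
      rintro w ⟨hwE, hw⟩
      rw [Metric.mem_closedBall] at hw
      rw [Metric.mem_sphere]
      by_contra hne
      have hlt := lt_of_le_of_ne hw hne
      apply hwE.2
      rw [← Metric.thickening_closure]
      refine Metric.mem_thickening_iff.2 ⟨y, hy, ?_⟩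
      have h3 : dist (x + (1 / ((n : ℝ) + 1)) • (y - x)) y ≤ (1 - 1 / ((n : ℝ) + 1)) * r := by
        have h4 : x + (1 / ((n : ℝ) + 1)) • (y - x) - y = (1 - 1 / ((n : ℝ) + 1)) • (x - y) := by
          module
        have h5 : 0 ≤ 1 - 1 / ((n : ℝ) + 1) := by
          rw [sub_nonneg, div_le_one hn]
          have : (0 : ℝ) ≤ n := by positivity
          linarith
        rw [dist_eq_norm, h4, norm_smul, Real.norm_of_nonneg h5, ← dist_eq_norm x y]
        gcongr
      calc dist w y ≤ _ + _ := dist_triangle _ (x + (1 / ((n : ℝ) + 1)) • (y - x)) _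
        _ < r / (n + 1) + (1 - 1 / ((n : ℝ) + 1)) * r := add_lt_add_of_lt_of_le hlt h3
        _ = r := by field_simp; ring
    rw [measure_mono_null hs (Measure.addHaar_sphere_of_ne_zero _ _ hpos.ne'), ENNReal.zero_div]
  simp only [H2] at H1
  exact zero_ne_one (tendsto_nhds_unique tendsto_const_nhds H1)

theorem mem_enlarge_iff {d : ℕ} {Ω : Set (Rd d)} {h : ℝ} (hh : 0 ≤ h) {x : Rd d} :
    x ∈ enlarge Ω h ↔ ∃ y ∈ Ω, dist x y ≤ h := by
  rw [enlarge, smul_unitClosedBall, Real.norm_of_nonneg hh, Set.mem_add]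
  constructor
  · rintro ⟨y, hy, z, hz, rfl⟩
    exact ⟨y, hy, by simpa [dist_eq_norm] using hz⟩
  · rintro ⟨y, hy, hxy⟩
    exact ⟨y, hy, x - y, by simpa [dist_eq_norm] using hxy, by simp⟩

theorem subset_enlarge {d : ℕ} (Ω : Set (Rd d)) {h : ℝ} (hh : 0 ≤ h) : Ω ⊆ enlarge Ω h :=
  fun x hx => (mem_enlarge_iff hh).2 ⟨x, hx, by simpa⟩

theorem enlarge_ae_eq_cthickening {d : ℕ} (Ω : Set (Rd d)) {h : ℝ} (hh : 0 < h) :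
    enlarge Ω h =ᵐ[volume] Metric.cthickening h Ω := by
  have h1 : Metric.thickening h Ω ⊆ enlarge Ω h := fun x hx => by
    obtain ⟨y, hy, hxy⟩ := Metric.mem_thickening_iff.1 hx
    exact (mem_enlarge_iff hh.le).2 ⟨y, hy, hxy.le⟩
  have h2 : enlarge Ω h ⊆ Metric.cthickening h Ω := fun x hx => by
    obtain ⟨y, hy, hxy⟩ := (mem_enlarge_iff hh.le).1 hx
    exact Metric.mem_cthickening_of_dist_le x y h Ω hy hxy
  refine h2.eventuallyLE.antisymm (ae_le_set.2 ?_)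
  exact measure_mono_null (sdiff_subset_sdiff_right h1) (volume_cthickening_diff_thickening Ω hh)

theorem nullMeasurableSet_enlarge {d : ℕ} (Ω : Set (Rd d)) {h : ℝ} (hh : 0 < h) :
    NullMeasurableSet (enlarge Ω h) :=
  Metric.isClosed_cthickening.measurableSet.nullMeasurableSet.congr
    (enlarge_ae_eq_cthickening Ω hh).symm

noncomputable section

/-- The rescaled Lebesgue measure `h⁻¹ 1_{(Ω + h B₁) \ Ω} dx` of the outer collar of `Ω`. -/
def collarMeasure {d : ℕ} (Ω : Set (Rd d)) (h : ℝ) : Measure (Rd d) :=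
  (ENNReal.ofReal h)⁻¹ • volume.restrict (enlarge Ω h \ Ω)

end

theorem collarMeasure_univ {d : ℕ} (Ω : Set (Rd d)) (h : ℝ) :
    collarMeasure Ω h univ = volume (enlarge Ω h \ Ω) / ENNReal.ofReal h := by
  simp [collarMeasure, ENNReal.div_eq_inv_mul]

theorem collarMeasure_univ_eq_cthickening {d : ℕ} (Ω : Set (Rd d)) {h : ℝ} (hh : 0 < h) :
    collarMeasure Ω h univ = volume (Metric.cthickening h Ω \ Ω) / ENNReal.ofReal h := by
  rw [collarMeasure_univ,
    measure_congr ((enlarge_ae_eq_cthickening Ω hh).diff (ae_eq_refl Ω))]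

/-! ### Lower semicontinuity of the variation on open sets -/

theorem ofReal_integral_le_lintegral_ofReal {α : Type*} [MeasurableSpace α] {μ : Measure α}
    (f : α → ℝ) : ENNReal.ofReal (∫ x, f x ∂μ) ≤ ∫⁻ x, ENNReal.ofReal (f x) ∂μ := by
  by_cases hf : Integrable f μ
  · rw [integral_eq_lintegral_pos_part_sub_lintegral_neg_part hf]
    refine (ENNReal.ofReal_le_ofReal (sub_le_self _ ENNReal.toReal_nonneg)).trans ?_
    exact ENNReal.ofReal_toReal_le
  · simp [integral_undef hf]

theorem integrable_charFn {d : ℕ} {Ω : Set (Rd d)} (hΩ : MeasurableSet Ω)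
    (hvol : volume Ω ≠ ⊤) : Integrable (charFn Ω) :=
  (integrable_indicator_iff hΩ).2 (integrableOn_const hvol (C := (1 : ℝ)))

/-- A translation moves the difference onto `1_Ω`. Then `1_Ω(x - tv) - 1_Ω(x)` is at most `1` on the
collar and nonpositive off it, since `x - tv ∈ Ω` forces `x ∈ Ω + tB₁`. -/
theorem integral_differenceQuotient_mul_charFn_le {d : ℕ} {Ω : Set (Rd d)} (hΩ : MeasurableSet Ω)
    (hvol : volume Ω ≠ ⊤) {φ : Rd d → ℝ} (hφ : Continuous φ) (hφc : HasCompactSupport φ)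
    (hφ0 : ∀ x, 0 ≤ φ x) {v : Rd d} (hv : ‖v‖ ≤ 1) {t : ℝ} (ht : 0 < t) :
    ENNReal.ofReal (∫ x, t⁻¹ • (φ (x + t • v) - φ x) * charFn Ω x) ≤
      ∫⁻ x, ENNReal.ofReal (φ x) ∂collarMeasure Ω t := by
  have hu := integrable_charFn hΩ hvol
  obtain ⟨C, hC⟩ := hφc.exists_bound_of_continuous hφ
  have hI1 : Integrable fun x => φ (x + t • v) * charFn Ω x :=
    hu.bdd_mul (c := C) (hφ.comp (by fun_prop)).aestronglyMeasurable
      (Eventually.of_forall fun x => hC _)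
  have hI2 : Integrable fun x => φ x * charFn Ω x :=
    hu.bdd_mul (c := C) hφ.aestronglyMeasurable (Eventually.of_forall fun x => hC _)
  have hI3 : Integrable fun x => φ x * charFn Ω (x - t • v) :=
    (hu.comp_sub_right (t • v)).bdd_mul (c := C) hφ.aestronglyMeasurable
      (Eventually.of_forall fun x => hC _)
  have key : ∫ x, t⁻¹ • (φ (x + t • v) - φ x) * charFn Ω x =
      ∫ x, t⁻¹ * (φ x * (charFn Ω (x - t • v) - charFn Ω x)) := by
    rw [integral_const_mul]
    simp only [smul_eq_mul, mul_assoc]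
    rw [integral_const_mul]
    simp only [sub_mul, mul_sub]
    rw [integral_sub hI1 hI2, integral_sub hI3 hI2,
      ← integral_add_right_eq_self (fun x => φ x * charFn Ω (x - t • v)) (t • v)]
    simp
  rw [key]
  refine (ofReal_integral_le_lintegral_ofReal _).trans ?_
  have hm : NullMeasurableSet (enlarge Ω t \ Ω) :=
    (nullMeasurableSet_enlarge Ω ht).diff hΩ.nullMeasurableSet
  rw [collarMeasure, lintegral_smul_measure, ← lintegral_indicator₀ hm, smul_eq_mul,
    ← lintegral_const_mul']
  swap
  · simp [ht]
  refine lintegral_mono fun x => ?_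
  rw [ENNReal.ofReal_mul (by positivity), ENNReal.ofReal_inv_of_pos ht]
  gcongr
  by_cases hx : x ∈ enlarge Ω t \ Ω
  · rw [indicator_of_mem hx]
    refine ENNReal.ofReal_le_ofReal ?_
    have h0 : charFn Ω x = 0 := by simp [charFn, hx.2]
    have h1 : charFn Ω (x - t • v) ≤ 1 :=
      indicator_le_self' (by simp) (x - t • v)
    rw [h0, sub_zero]
    exact mul_le_of_le_one_right (hφ0 x) h1
  · rw [indicator_of_notMem hx, nonpos_iff_eq_zero, ENNReal.ofReal_eq_zero]
    refine mul_nonpos_of_nonneg_of_nonpos (hφ0 x) (sub_nonpos.2 ?_)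
    by_cases hxΩ : x ∈ Ω
    · simp only [charFn, indicator_of_mem hxΩ]
      exact indicator_le_self' (by simp) (x - t • v)
    · have : x - t • v ∉ Ω := fun hm => hx ⟨(mem_enlarge_iff ht.le).2 ⟨_, hm, by
        rw [dist_eq_norm, sub_sub_cancel, norm_smul, Real.norm_of_nonneg ht.le]
        exact mul_le_of_le_one_right ht.le hv⟩, hxΩ⟩
      simp [charFn, hxΩ, this]

/-- Testing the distributional gradient of `1_Ω` against a nonnegative function in a fixed
direction is controlled by the collar measures. -/
theorem inner_integral_le_liminf_collarMeasure {d : ℕ} {Ω : Set (Rd d)} (hΩ : MeasurableSet Ω)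
    (hvol : volume Ω ≠ ⊤) {D : VectorMeasure (Rd d) (Rd d)} (hD : IsDistribGradient (charFn Ω) D)
    {φ : Rd d → ℝ} (hφ : ContDiff ℝ ∞ φ) (hφc : HasCompactSupport φ)
    (hφ0 : ∀ x, 0 ≤ φ x) {v : Rd d} (hv : ‖v‖ ≤ 1) :
    ENNReal.ofReal ⟪v, ∫ᵛ x, φ x ∂•D⟫ ≤
      liminf (fun h => ∫⁻ x, ENNReal.ofReal (φ x) ∂collarMeasure Ω h) (𝓝[>] 0) := by
  have hu := integrable_charFn hΩ hvol
  obtain ⟨C, hC⟩ := hφ.lipschitzWith_of_hasCompactSupport hφc (by simp)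
  -- The direction `-v` absorbs the minus sign in the definition of `D`.
  have hlim := hC.integral_inv_smul_sub_mul_tendsto_integral_lineDeriv_mul hu (-v)
  have hcont : Continuous (∇ φ) :=
    (InnerProductSpace.toDual ℝ (Rd d)).symm.continuous.comp (hφ.continuous_fderiv (by simp))
  have hgc : HasCompactSupport (∇ φ) :=
    (hφc.fderiv (𝕜 := ℝ)).comp_left (g := (InnerProductSpace.toDual ℝ (Rd d)).symm) (map_zero _)
  obtain ⟨B, hB⟩ := hgc.exists_bound_of_continuous hcont
  have hint : Integrable fun x => charFn Ω x • ∇ φ x :=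
    hu.smul_bdd B hcont.aestronglyMeasurable (Eventually.of_forall hB)
  have heq : ∫ x, lineDeriv ℝ φ x (-v) * charFn Ω x = ⟪v, ∫ᵛ x, φ x ∂•D⟫ := by
    have h1 : ∫ᵛ x, φ x ∂•D = - ∫ x, charFn Ω x • ∇ φ x := by rw [hD φ hφ hφc, neg_neg]
    rw [h1, inner_neg_right, ← integral_inner hint, ← integral_neg]
    congr 1 with x
    have hd : DifferentiableAt ℝ φ x := hφ.differentiable (by simp) x
    rw [hd.lineDeriv_eq_fderiv, inner_smul_right, real_inner_comm, gradient,
      InnerProductSpace.toDual_symm_apply, map_neg]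
    ring
  rw [heq] at hlim
  have hlim' := (ENNReal.continuous_ofReal.tendsto _).comp hlim
  rw [← hlim'.liminf_eq]
  refine liminf_le_liminf ?_
  filter_upwards [self_mem_nhdsWithin] with t ht
  exact integral_differenceQuotient_mul_charFn_le hΩ hvol hφ.continuous hφc hφ0 (by simpa) ht

/-- A smooth cutoff between a compact set and an open neighbourhood. -/
theorem exists_contDiff_cutoff {d : ℕ} {K U : Set (Rd d)} (hK : IsCompact K) (hU : IsOpen U)
    (hKU : K ⊆ U) : ∃ φ : Rd d → ℝ, ContDiff ℝ ∞ φ ∧ HasCompactSupport φ ∧ (∀ x, 0 ≤ φ x) ∧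
      (∀ x, φ x ≤ 1) ∧ (∀ x ∈ K, φ x = 1) ∧ ∀ x ∉ U, φ x = 0 := by
  obtain ⟨L, hL, hKL, hLU⟩ := exists_compact_between hK hU hKU
  obtain ⟨f, hf1, hf0, hf⟩ := exists_contMDiffMap_one_nhds_of_subset_interior
    (n := (⊤ : ℕ∞)) (modelWithCornersSelf ℝ (Rd d)) hK.isClosed hKL
  exact ⟨f, f.contMDiff.contDiff, HasCompactSupport.intro hL hf0, fun x => (hf x).1,
    fun x => (hf x).2, fun x hx => hf1.self_of_nhdsSet x hx, fun x hx => hf0 x fun h => hx (hLU h)⟩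

/-- `φ - 1_K` vanishes on `K` and off `U`, and is at most `1` in absolute value between. -/
theorem enorm_integral_sub_apply_le {X F : Type*} [MeasurableSpace X] [NormedAddCommGroup F]
    [NormedSpace ℝ F] [CompleteSpace F] {D : VectorMeasure X F} [IsFiniteMeasure D.variation]
    {φ : X → ℝ} (hφ : Measurable φ) (hφ0 : ∀ x, 0 ≤ φ x) (hφ1 : ∀ x, φ x ≤ 1)
    {K U : Set X} (hK : MeasurableSet K) (hU : MeasurableSet U)
    (hφK : ∀ x ∈ K, φ x = 1) (hφU : ∀ x ∉ U, φ x = 0) :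
    ‖∫ᵛ x, φ x ∂•D - D K‖ₑ ≤ D.variation (U \ K) := by
  have hi : D.Integrable φ := Integrable.of_bound (C := 1) hφ.aestronglyMeasurable
    (Eventually.of_forall fun x => by rw [Real.norm_of_nonneg (hφ0 x)]; exact hφ1 x)
  have hi1 : D.Integrable (K.indicator fun _ => (1 : ℝ)) :=
    (integrable_indicator_iff hK).2 (integrableOn_const (measure_ne_top _ _))
  have h1 : D K = ∫ᵛ x, K.indicator (fun _ => (1 : ℝ)) x ∂•D := by
    rw [VectorMeasure.integral_indicator hK, VectorMeasure.integral_const]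
    simp [VectorMeasure.restrict_apply, hK]
  rw [h1, ← VectorMeasure.integral_fun_sub hi hi1]
  refine VectorMeasure.enorm_integral_le_lintegral_enorm_transpose.trans ?_
  rw [VectorMeasure.variation_transpose_lsmul, ← lintegral_indicator_one (hU.diff hK)]
  refine lintegral_mono fun x => ?_
  by_cases hxK : x ∈ K
  · simp [hxK, hφK x hxK]
  by_cases hxU : x ∈ U
  · simp only [hxK, not_false_eq_true, indicator_of_notMem, sub_zero, Set.mem_sdiff, hxU, and_self,
      indicator_of_mem, Pi.one_apply]
    rw [Real.enorm_of_nonneg (hφ0 x)]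
    exact ENNReal.ofReal_le_one.2 (hφ1 x)
  · simp [hxK, hφU x hxU]

/-- Test in the direction of `D K` with a cutoff of `K` supported in `U`; outer regularity makes the
cutoff error small. -/
theorem enorm_apply_le_liminf_collarMeasure {d : ℕ} {Ω : Set (Rd d)} (hΩ : MeasurableSet Ω)
    (hvol : volume Ω ≠ ⊤) {D : VectorMeasure (Rd d) (Rd d)} [IsFiniteMeasure D.variation]
    (hD : IsDistribGradient (charFn Ω) D) {K U : Set (Rd d)} (hK : IsCompact K) (hU : IsOpen U)
    (hKU : K ⊆ U) : ‖D K‖ₑ ≤ liminf (fun h => collarMeasure Ω h U) (𝓝[>] 0) := by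
  by_cases h0 : D K = 0
  · simp [h0]
  refine ENNReal.le_of_forall_pos_le_add fun ε hε _ => ?_
  obtain ⟨V, hKV, hV, hVε⟩ := K.exists_isOpen_lt_add (μ := D.variation) (measure_ne_top _ _)
    (ε := (ε : ℝ≥0∞)) (by simpa using hε.ne')
  obtain ⟨φ, hφ, hφc, hφ0, hφ1, hφK, hφU⟩ :=
    exists_contDiff_cutoff hK (hU.inter hV) (subset_inter hKU hKV)
  have hdiff : ‖∫ᵛ x, φ x ∂•D - D K‖ₑ ≤ ε := by
    refine (enorm_integral_sub_apply_le hφ.continuous.measurable hφ0 hφ1 hK.measurableSet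
      (hU.inter hV).measurableSet hφK hφU).trans ?_
    refine (measure_mono (sdiff_subset_sdiff_left inter_subset_right)).trans ?_
    exact (measure_sdiff_le_iff_le_add hK.measurableSet.nullMeasurableSet hKV
      (measure_ne_top _ _)).2 hVε.le
  have hn : ‖D K‖ ≠ 0 := norm_ne_zero_iff.2 h0
  set e : Rd d := ‖D K‖⁻¹ • D K with he
  have he1 : ‖e‖ = 1 := by rw [he, norm_smul, norm_inv, norm_norm, inv_mul_cancel₀ hn]
  have heD : ⟪e, D K⟫ = ‖D K‖ := by
    rw [he, real_inner_smul_left, real_inner_self_eq_norm_sq]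
    field_simp
  have htest := inner_integral_le_liminf_collarMeasure hΩ hvol hD hφ hφc hφ0 he1.le
  have hle : ‖D K‖ ≤ ⟪e, ∫ᵛ x, φ x ∂•D⟫ + ‖∫ᵛ x, φ x ∂•D - D K‖ := by
    have h1 := real_inner_le_norm e (D K - ∫ᵛ x, φ x ∂•D)
    rw [inner_sub_right, heD, he1, one_mul, norm_sub_rev] at h1
    linarith
  calc ‖D K‖ₑ = ENNReal.ofReal ‖D K‖ := (ofReal_norm _).symm
    _ ≤ ENNReal.ofReal ⟪e, ∫ᵛ x, φ x ∂•D⟫ + ENNReal.ofReal ‖∫ᵛ x, φ x ∂•D - D K‖ :=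
      (ENNReal.ofReal_le_ofReal hle).trans ENNReal.ofReal_add_le
    _ ≤ liminf (fun h => collarMeasure Ω h U) (𝓝[>] 0) + ε := by
      gcongr
      · refine htest.trans (liminf_le_liminf (Eventually.of_forall fun h => ?_))
        rw [← lintegral_indicator_one hU.measurableSet]
        refine lintegral_mono fun x => ?_
        by_cases hx : x ∈ U
        · simpa [hx] using hφ1 x
        · simp [hφU x fun hm => hx hm.1]
      · rwa [ofReal_norm]

/-- Fatou's lemma for counting measure. -/
theorem sum_liminf_le_liminf_sum {ι α : Type*} {l : Filter α} [l.IsCountablyGenerated]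
    (s : Finset ι) (f : ι → α → ℝ≥0∞) :
    ∑ i ∈ s, liminf (f i) l ≤ liminf (fun a => ∑ i ∈ s, f i a) l := by
  let _ : MeasurableSpace s := ⊤
  have h := lintegral_liminf_le (μ := Measure.count) (u := l)
    (f := fun a (i : s) => f i a) fun _ => measurable_from_top
  simpa only [lintegral_count, tsum_fintype, Finset.sum_coe_sort s fun i => liminf (f i) l,
    fun a => Finset.sum_coe_sort s fun i => f i a] using h

/-- Finitely many pairwise disjoint compact sets have pairwise disjoint thickenings of a common
radius. -/
theorem exists_pairwiseDisjoint_thickening {X ι : Type*} [PseudoEMetricSpace X] [T2Space X]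
    (s : Finset ι) (K : ι → Set X) (hK : ∀ i ∈ s, IsCompact (K i))
    (hd : (s : Set ι).PairwiseDisjoint K) :
    ∃ δ > 0, (s : Set ι).PairwiseDisjoint fun i => Metric.thickening δ (K i) := by
  have h : ∀ᶠ δ : ℝ in 𝓝[>] 0, ∀ i ∈ s, ∀ j ∈ s, i ≠ j →
      Disjoint (Metric.thickening δ (K i)) (Metric.thickening δ (K j)) := by
    rw [Finset.eventually_all]
    intro i hi
    rw [Finset.eventually_all]
    intro j hj
    by_cases hij : i = j
    · simp [hij]
    obtain ⟨δ, hδ, hdis⟩ :=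
      (hd hi hj hij).exists_thickenings (hK i hi) (hK j hj).isClosed
    filter_upwards [Ioo_mem_nhdsGT hδ] with η hη _
    exact hdis.mono (Metric.thickening_mono hη.2.le _) (Metric.thickening_mono hη.2.le _)
  obtain ⟨δ, hδ, hδ0⟩ := (h.and self_mem_nhdsWithin).exists
  exact ⟨δ, hδ0, fun i hi j hj hij => hδ i hi j hj hij⟩

/-- Lower semicontinuity: the total variation of `D 1_Ω` on an open set is at most the lower
limit of the collar measures of that set. -/
theorem variation_le_liminf_collarMeasure {d : ℕ} {Ω : Set (Rd d)} (hΩ : MeasurableSet Ω)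
    (hvol : volume Ω ≠ ⊤) {D : VectorMeasure (Rd d) (Rd d)} [IsFiniteMeasure D.variation]
    (hD : IsDistribGradient (charFn Ω) D) {G : Set (Rd d)} (hG : IsOpen G) :
    D.variation G ≤ liminf (fun h => collarMeasure Ω h G) (𝓝[>] 0) := by
  refine ENNReal.le_of_forall_pos_le_add fun ε hε _ => ?_
  have hε2 : (0 : ℝ≥0∞) < ε / 2 := ENNReal.div_pos (by simpa using hε.ne') (by simp)
  -- The pieces of a nearly optimal partition are shrunk to compact sets, then enlarged to disjoint
  -- open sets, so that their collar masses add up to at most that of `G`.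
  obtain ⟨P, hPG, hPd, hPm, hP⟩ := D.exists_variation_le_add' hG.measurableSet hε2
    (measure_ne_top _ _)
  have hη : (ε / 2 / (P.card + 1) : ℝ≥0∞) ≠ 0 := by
    simpa [ENNReal.div_eq_zero_iff] using hε.ne'
  have hK : ∀ p : Set (Rd d), ∃ K, p ∈ P → K ⊆ p ∧ IsCompact K ∧
      D.variation (p \ K) < (ε / 2 / (P.card + 1) : ℝ≥0∞) := fun p => by
    by_cases hp : p ∈ P
    · obtain ⟨K, hK⟩ := (hPm p hp).exists_isCompact_sdiff_lt (μ := D.variation)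
        (measure_ne_top _ _) hη
      exact ⟨K, fun _ => hK⟩
    · exact ⟨∅, fun h => absurd h hp⟩
  choose K hK using hK
  have hKd : (P : Set (Set (Rd d))).PairwiseDisjoint K := fun p hp q hq hpq =>
    (hPd hp hq hpq).mono (hK p hp).1 (hK q hq).1
  obtain ⟨δ, hδ, hdis⟩ := exists_pairwiseDisjoint_thickening P K (fun p hp => (hK p hp).2.1) hKd
  set U : Set (Rd d) → Set (Rd d) := fun p => G ∩ Metric.thickening δ (K p) with hU
  have hUo : ∀ p, IsOpen (U p) := fun p => hG.inter Metric.isOpen_thickening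
  have hUd : (P : Set (Set (Rd d))).PairwiseDisjoint U :=
    hdis.mono fun p => inter_subset_right
  have h1 : ∀ p ∈ P, ‖D p‖ₑ ≤ liminf (fun h => collarMeasure Ω h (U p)) (𝓝[>] 0) +
      (ε / 2 / (P.card + 1) : ℝ≥0∞) := fun p hp => by
    have hKm := (hK p hp).2.1.measurableSet
    have h2 : D p = D (K p) + D (p \ K p) := by
      rw [← D.of_union disjoint_sdiff_right hKm ((hPm p hp).diff hKm),
        union_sdiff_cancel (hK p hp).1]
    rw [h2]
    refine (enorm_add_le _ _).trans (add_le_add ?_ ?_)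
    · exact enorm_apply_le_liminf_collarMeasure hΩ hvol hD (hK p hp).2.1 (hUo p)
        (subset_inter ((hK p hp).1.trans (hPG p hp)) (Metric.self_subset_thickening hδ _))
    · exact (D.enorm_measure_le_variation _).trans (hK p hp).2.2.le
  calc D.variation G ≤ ∑ p ∈ P, ‖D p‖ₑ + ε / 2 := hP
    _ ≤ ∑ p ∈ P, (liminf (fun h => collarMeasure Ω h (U p)) (𝓝[>] 0) +
        (ε / 2 / (P.card + 1) : ℝ≥0∞)) + ε / 2 := by gcongr with p hp; exact h1 p hp
    _ ≤ (liminf (fun h => collarMeasure Ω h G) (𝓝[>] 0) + ε / 2) + ε / 2 := by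
      rw [Finset.sum_add_distrib]
      gcongr
      · refine (sum_liminf_le_liminf_sum P _).trans
          (liminf_le_liminf (Eventually.of_forall fun h => ?_))
        rw [← measure_biUnion_finset hUd fun p _ => (hUo p).measurableSet]
        exact measure_mono (iUnion₂_subset fun p _ => inter_subset_left)
      · rw [Finset.sum_const, nsmul_eq_mul]
        calc (P.card : ℝ≥0∞) * (ε / 2 / (P.card + 1))
            ≤ (P.card + 1) * (ε / 2 / (P.card + 1)) := by gcongr; exact le_self_add
          _ ≤ ε / 2 := ENNReal.mul_div_le
    _ = liminf (fun h => collarMeasure Ω h G) (𝓝[>] 0) + ε := by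
      rw [add_assoc, ENNReal.add_halves]

/-! ### Weak convergence from open-set bounds and convergence of mass -/

section WeakConvergence

variable {X : Type*} [TopologicalSpace X] [MeasurableSpace X] [OpensMeasurableSpace X]

theorem Continuous.integrable_of_norm_le_one {E : Type*} [NormedAddCommGroup E]
    [SecondCountableTopologyEither X E] {μ : Measure X} [IsFiniteMeasure μ] {f : X → E}
    (hf : Continuous f) (hf1 : ∀ x, ‖f x‖ ≤ 1) : Integrable f μ :=
  Integrable.of_bound (C := 1) hf.aestronglyMeasurable (Eventually.of_forall hf1)

variable {μ : Measure X} [IsFiniteMeasure μ] {ν : ℕ → Measure X}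

/-- The open-set bounds yield a Fatou inequality for nonnegative functions; apply it to `1 + f` and
subtract the converging masses. -/
theorem eventually_lt_integral_of_le_liminf
    (hopen : ∀ G, IsOpen G → μ G ≤ liminf (fun n => ν n G) atTop)
    (hmass : Tendsto (fun n => ν n univ) atTop (𝓝 (μ univ)))
    {f : X → ℝ} (hf : Continuous f) (hf1 : ∀ x, ‖f x‖ ≤ 1) {a : ℝ} (ha : a < ∫ x, f x ∂μ) :
    ∀ᶠ n in atTop, a < ∫ x, f x ∂ν n := by
  have hfin : ∀ᶠ n in atTop, ν n univ < ⊤ := hmass.eventually_lt_const (measure_lt_top μ univ)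
  have hg0 : ∀ x, 0 ≤ 1 + f x := fun x => by linarith [(abs_le.1 (hf1 x)).1]
  have hlint : ∀ (m : Measure X) [IsFiniteMeasure m],
      ENNReal.ofReal (m.real univ + ∫ x, f x ∂m) = ∫⁻ x, ENNReal.ofReal (1 + f x) ∂m := by
    intro m _
    have hfi : Integrable f m := hf.integrable_of_norm_le_one hf1
    have hgi : Integrable (fun x => 1 + f x) m := (integrable_const 1).add hfi
    rw [← ofReal_integral_eq_lintegral_ofReal hgi (Eventually.of_forall hg0), integral_add (integrable_const 1) hfi]
    simp
  have hle := lintegral_le_liminf_lintegral_of_forall_isOpen_measure_le_liminf_measure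
    (f := fun x => 1 + f x) (by fun_prop) hg0 hopen
  rw [← hlint μ] at hle
  set ε := ((∫ x, f x ∂μ) - a) / 2 with hε
  have hεpos : 0 < ε := by rw [hε]; linarith
  have hreal : Tendsto (fun n => (ν n).real univ) atTop (𝓝 (μ.real univ)) :=
    (ENNReal.tendsto_toReal (measure_ne_top μ univ)).comp hmass
  have hev1 : ∀ᶠ n in atTop, (ν n).real univ < μ.real univ + ε :=
    hreal.eventually_lt_const (by linarith)
  have hev2 : ∀ᶠ n in atTop,
      μ.real univ + (∫ x, f x ∂μ) - ε < (ν n).real univ + ∫ x, f x ∂ν n := by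
    by_cases hpos : 0 < μ.real univ + ∫ x, f x ∂μ
    · have hlt : ENNReal.ofReal (μ.real univ + (∫ x, f x ∂μ) - ε) <
          liminf (fun n => ∫⁻ x, ENNReal.ofReal (1 + f x) ∂ν n) atTop :=
        lt_of_lt_of_le ((ENNReal.ofReal_lt_ofReal_iff hpos).2 (by linarith)) hle
      filter_upwards [eventually_lt_of_lt_liminf hlt, hfin] with n hn hn'
      have : IsFiniteMeasure (ν n) := ⟨hn'⟩
      rw [← hlint (ν n)] at hn
      exact (ENNReal.ofReal_lt_ofReal_iff'.1 hn).1
    -- Here `ENNReal.ofReal` truncates to `0` and the liminf says nothing, but `1 + f ≥ 0` suffices.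
    · filter_upwards [hfin] with n hn'
      have : IsFiniteMeasure (ν n) := ⟨hn'⟩
      have h1 : 0 ≤ ∫ x, 1 + f x ∂ν n := integral_nonneg hg0
      rw [integral_add (integrable_const 1) (hf.integrable_of_norm_le_one hf1)] at h1
      simp only [integral_const, smul_eq_mul, mul_one] at h1
      linarith
  filter_upwards [hev1, hev2] with n h1 h2
  linarith

theorem tendsto_integral_of_le_liminf
    (hopen : ∀ G, IsOpen G → μ G ≤ liminf (fun n => ν n G) atTop)
    (hmass : Tendsto (fun n => ν n univ) atTop (𝓝 (μ univ)))
    {f : X → ℝ} (hf : Continuous f) (hf1 : ∀ x, ‖f x‖ ≤ 1) :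
    Tendsto (fun n => ∫ x, f x ∂ν n) atTop (𝓝 (∫ x, f x ∂μ)) := by
  refine tendsto_order.2 ⟨fun a ha => eventually_lt_integral_of_le_liminf hopen hmass hf hf1 ha,
    fun a ha => ?_⟩
  have h := eventually_lt_integral_of_le_liminf hopen hmass (f := fun x => -f x)
    hf.neg (fun x => by rw [norm_neg]; exact hf1 x) (a := -a) (by rw [integral_neg]; linarith)
  filter_upwards [h] with n hn
  rw [integral_neg] at hn
  linarith

/-- If the masses converge and the masses of open sets are lower semicontinuous along a countably
generated filter, then integrals of bounded continuous functions converge. -/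
theorem tendsto_integral_complex_of_le_liminf {ι : Type*} {l : Filter ι} [l.IsCountablyGenerated]
    {ρ : ι → Measure X}
    (hopen : ∀ G, IsOpen G → μ G ≤ liminf (fun i => ρ i G) l)
    (hmass : Tendsto (fun i => ρ i univ) l (𝓝 (μ univ)))
    {f : X → ℂ} (hf : Continuous f) (hf1 : ∀ x, ‖f x‖ ≤ 1) :
    Tendsto (fun i => ∫ x, f x ∂ρ i) l (𝓝 (∫ x, f x ∂μ)) := by
  refine tendsto_of_seq_tendsto fun u hu => ?_
  have hopen' : ∀ G, IsOpen G → μ G ≤ liminf (fun n => ρ (u n) G) atTop := fun G hG =>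
    (hopen G hG).trans (liminf_le_liminf_of_le hu)
  have hmass' := hmass.comp hu
  have hre := tendsto_integral_of_le_liminf hopen' hmass' (Complex.continuous_re.comp hf)
    fun x => (Complex.abs_re_le_norm _).trans (hf1 x)
  have him := tendsto_integral_of_le_liminf hopen' hmass' (Complex.continuous_im.comp hf)
    fun x => (Complex.abs_im_le_norm _).trans (hf1 x)
  have hsplit : ∀ (m : Measure X) [IsFiniteMeasure m],
      ∫ x, f x ∂m = ((∫ x, (f x).re ∂m : ℝ) : ℂ) + ((∫ x, (f x).im ∂m : ℝ) : ℂ) * Complex.I :=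
    fun m _ => (integral_re_add_im (𝕜 := ℂ) (hf.integrable_of_norm_le_one hf1)).symm
  rw [hsplit μ]
  refine Tendsto.congr' ?_ (((Complex.continuous_ofReal.tendsto _).comp hre).add
    (((Complex.continuous_ofReal.tendsto _).comp him).mul_const Complex.I))
  filter_upwards [hmass'.eventually_lt_const (measure_lt_top μ univ)] with n hn
  have : IsFiniteMeasure (ρ (u n)) := ⟨hn⟩
  exact (hsplit _).symm

end WeakConvergence

/-! ### Fourier transforms and the equivalence -/

theorem continuous_fourierKernel {d : ℕ} (ξ : Rd d) :
    Continuous fun x : Rd d => Complex.exp (((-2 * Real.pi * ⟪ξ, x⟫ : ℝ) : ℂ) * Complex.I) := by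
  fun_prop

theorem norm_fourierKernel {d : ℕ} (ξ x : Rd d) :
    ‖Complex.exp (((-2 * Real.pi * ⟪ξ, x⟫ : ℝ) : ℂ) * Complex.I)‖ = 1 :=
  Complex.norm_exp_ofReal_mul_I _

theorem fourierSet_eq_fourierMeasure_restrict {d : ℕ} {S : Set (Rd d)} (hS : NullMeasurableSet S)
    (ξ : Rd d) : fourierSet S ξ = fourierMeasure (volume.restrict S) ξ := by
  rw [fourierSet, fourierMeasure, Real.fourier_eq', ← integral_indicator₀ hS]
  congr 1 with x
  by_cases hx : x ∈ S <;> simp [charFn, hx, real_inner_comm]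

theorem fourierSet_enlarge_sub_div {d : ℕ} {Ω : Set (Rd d)} (hΩ : MeasurableSet Ω) {h : ℝ}
    (hh : 0 < h) (hvol : volume (enlarge Ω h) < ⊤) (ξ : Rd d) :
    (fourierSet (enlarge Ω h) ξ - fourierSet Ω ξ) / (h : ℂ) =
      fourierMeasure (collarMeasure Ω h) ξ := by
  rw [fourierSet_eq_fourierMeasure_restrict (nullMeasurableSet_enlarge Ω hh),
    fourierSet_eq_fourierMeasure_restrict hΩ.nullMeasurableSet]
  have : IsFiniteMeasure (volume.restrict (enlarge Ω h)) := ⟨by simpa using hvol⟩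
  have hi : IntegrableOn
      (fun x : Rd d => Complex.exp (((-2 * Real.pi * ⟪ξ, x⟫ : ℝ) : ℂ) * Complex.I))
      (enlarge Ω h) volume :=
    (continuous_fourierKernel ξ).integrable_of_norm_le_one fun x => (norm_fourierKernel ξ x).le
  simp only [fourierMeasure, collarMeasure]
  rw [integral_smul_measure, setIntegral_sdiff hΩ hi (subset_enlarge Ω hh.le), ENNReal.toReal_inv,
    ENNReal.toReal_ofReal hh.le, Complex.real_smul, Complex.ofReal_inv, div_eq_inv_mul]

theorem fourierMeasure_zero {d : ℕ} (μ : Measure (Rd d)) :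
    fourierMeasure μ 0 = (μ.real univ : ℂ) := by
  simp [fourierMeasure, Measure.real]

theorem isDistribGradient_distribGradient {d : ℕ} {u : Rd d → ℝ} (hu : HasMeasureGradient u) :
    IsFiniteMeasure (distribGradient u).variation ∧ IsDistribGradient u (distribGradient u) := by
  rw [distribGradient, dif_pos hu]
  exact hu.choose_spec

theorem eventually_volume_enlarge_lt_top {d : ℕ} {Ω : Set (Rd d)} (hvol : volume Ω < ⊤)
    {m : ℝ≥0∞} (hm : m < ⊤)
    (h : Tendsto (fun h => collarMeasure Ω h univ) (𝓝[>] 0) (𝓝 m)) :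
    ∀ᶠ h : ℝ in 𝓝[>] 0, volume (enlarge Ω h) < ⊤ := by
  filter_upwards [h.eventually_lt_const hm, self_mem_nhdsWithin] with t ht ht0
  rw [collarMeasure_univ] at ht
  have h1 : volume (enlarge Ω t \ Ω) < ⊤ := by
    by_contra hc
    rw [not_lt_top_iff.1 hc, ENNReal.top_div_of_ne_top ENNReal.ofReal_ne_top] at ht
    exact lt_irrefl _ ht
  exact (measure_mono (subset_sdiff_union _ Ω)).trans_lt
    ((measure_union_le _ _).trans_lt (ENNReal.add_lt_top.2 ⟨h1, hvol⟩))

theorem hasOuterMinkowskiContent_iff_tendsto_collarMeasure {d : ℕ} {Ω : Set (Rd d)} {m : ℝ≥0∞} :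
    HasOuterMinkowskiContent Ω m ↔
      Tendsto (fun h => collarMeasure Ω h univ) (𝓝[>] 0) (𝓝 m) :=
  tendsto_congr' (by
    filter_upwards [self_mem_nhdsWithin] with h hh
    exact (collarMeasure_univ_eq_cthickening Ω hh).symm)

theorem mainTheorem6 (d : ℕ) (hd : 0 < d) (Ω : Set (Rd d))
    (hvol : volume Ω < ⊤) (hper : IsFinitePerimeter Ω) :
    ((∀ᶠ h : ℝ in 𝓝[>] 0, volume (enlarge Ω h) < ⊤) ∧
      ∀ ξ : Rd d, Tendsto (fun h : ℝ => (fourierSet (enlarge Ω h) ξ - fourierSet Ω ξ) / (h : ℂ))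
        (𝓝[>] 0) (𝓝 (fourierMeasure (perimeterMeasure Ω) ξ))) ↔
    HasOuterMinkowskiContent Ω (perimeter Ω) := by
  obtain ⟨hΩ, -, hgrad⟩ := hper
  obtain ⟨hfin, hD⟩ := isDistribGradient_distribGradient hgrad
  have : IsFiniteMeasure (perimeterMeasure Ω) := hfin
  have hP : perimeter Ω = perimeterMeasure Ω univ := if_pos hgrad
  rw [hP, hasOuterMinkowskiContent_iff_tendsto_collarMeasure]
  have hquot : (∀ᶠ h : ℝ in 𝓝[>] 0, volume (enlarge Ω h) < ⊤) → ∀ ξ : Rd d,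
      ∀ᶠ h : ℝ in 𝓝[>] 0, (fourierSet (enlarge Ω h) ξ - fourierSet Ω ξ) / (h : ℂ) =
        fourierMeasure (collarMeasure Ω h) ξ := fun hev ξ => by
    filter_upwards [hev, self_mem_nhdsWithin] with h hh h0
    exact fourierSet_enlarge_sub_div hΩ h0 hh ξ
  constructor
  · rintro ⟨hev, hlim⟩
    -- At frequency `0` the transforms are the total masses; finiteness of the volumes then lifts
    -- the real limit to `ℝ≥0∞`.
    have h0 := (tendsto_congr' (hquot hev 0)).1 (hlim 0)
    simp only [fourierMeasure_zero] at h0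
    have h1 : Tendsto (fun h => (collarMeasure Ω h).real univ) (𝓝[>] 0)
        (𝓝 ((perimeterMeasure Ω).real univ)) := by
      simpa [Function.comp_def] using (Complex.continuous_re.tendsto _).comp h0
    have h2 := (ENNReal.continuous_ofReal.tendsto _).comp h1
    rw [ofReal_measureReal] at h2
    refine h2.congr' ?_
    filter_upwards [hev, self_mem_nhdsWithin] with h hh hpos
    refine ofReal_measureReal ?_
    rw [collarMeasure_univ]
    exact ENNReal.div_ne_top ((measure_mono sdiff_subset).trans_lt hh).ne
      (ENNReal.ofReal_pos.2 hpos).ne'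
  · intro hmass
    have hev := eventually_volume_enlarge_lt_top hvol (measure_lt_top _ _) hmass
    refine ⟨hev, fun ξ => (tendsto_congr' (hquot hev ξ)).2 ?_⟩
    exact tendsto_integral_complex_of_le_liminf
      (fun G hG => variation_le_liminf_collarMeasure hΩ hvol.ne hD hG) hmass
      (continuous_fourierKernel ξ) fun x => (norm_fourierKernel ξ x).le
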